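/- Let $n>2$ and let $L=\sum_{k=1}^{n}a_k(x)D^k$, where $D=d/dx$, each $a_k$ is a real polynomial with $\deg a_k\le k$, and $a_n\neq 0$. Suppose that $L$ is self-adjoint in the following sense: there are a nonempty open interval $I\subseteq\mathbb{R}$ (bounded or unbounded) containing no zero of $a_n$, and a weight $p\ge 0$ on $I$ that is smooth off a finite set $F$, positive at some point of $I\setminus F$, and such that $pq$ is integrable over $I$ for every polynomial $q$, with $$\int_I p\,(Lu)\,v\,dx=\int_I p\,u\,(Lv)\,dx$$ for all $u,v:\mathbb{R}\to\mathbb{R}$ each of which is a polynomial or a compactly supported $C^\infty$ function. Write $a=a_n$ and $b=a_{n-1}$, and suppose that $a$ has at most one real root (not counting multiplicity). Then $$2\deg b-\deg a\le n-2\quad\text{or}\quad 3\deg b-2\deg a\le n-3.$$ (i) If $a$ has no real root, then $\deg a<\deg b\le n-3$. (ii) Suppose $a$ has exactly one real root $r$, of multiplicity $\alpha$ in $a$, let $\beta\ge 0$ be the multiplicity of $r$ as a root of $b$ (with $\beta=0$ if $b(r)\ne0$), and let $a=(x-r)^{\alpha}u$, $b=(x-r)^{\beta}v$ with polynomials $u,v$.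 Then $$2\le\deg a\le\deg b\le n-2\quad\text{and}\quad 1+\deg u\le\deg v\le n-3.$$ -/

import Mathlib

open MeasureTheory Polynomial
open scoped ContDiff

/-- The differential operator `L u = ∑_{k=1}^n a_k u^{(k)}` acting on functions. -/
noncomputable def diffOp (n : ℕ) (a : ℕ → ℝ[X]) (u : ℝ → ℝ) (x : ℝ) : ℝ :=
  ∑ k ∈ Finset.Icc 1 n, (a k).eval x * iteratedDeriv k u x

/-- Smooth functions whose products are integrable against every admissible weight:
polynomials and compactly supported smooth functions. -/
def IsTestFunction (u : ℝ → ℝ) : Prop :=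
  (∃ q : ℝ[X], u = fun x => q.eval x) ∨ (ContDiff ℝ ∞ u ∧ HasCompactSupport u)

/-- `p` is an admissible weight on `I`: it is nonnegative, not (essentially) zero, smooth off
finitely many points, and `p q` is integrable on `I` for every polynomial `q`. -/
structure IsAdmissibleWeight (I : Set ℝ) (p : ℝ → ℝ) : Prop where
  nonneg : ∀ x ∈ I, 0 ≤ p x
  piecewise_smooth : ∃ F : Set ℝ, F.Finite ∧ ContDiffOn ℝ ∞ p (I \ F) ∧ ∃ x ∈ I \ F, 0 < p x
  integrable : ∀ q : ℝ[X], IntegrableOn (fun x => p x * q.eval x) I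

/-- `L = ∑_{k=1}^n a_k D^k` is an operator of order exactly `n`, with `deg a_k ≤ k`, which is
self-adjoint for the inner product `⟨u, v⟩ = ∫_I p u v` of some admissible weight `p` on some
nonempty open interval `I` (bounded or not) that contains no zero of the leading coefficient. -/
def IsSelfAdjointDiffOp (n : ℕ) (a : ℕ → ℝ[X]) : Prop :=
  a n ≠ 0 ∧ (∀ k ∈ Finset.Icc 1 n, (a k).natDegree ≤ k) ∧
    ∃ (I : Set ℝ) (p : ℝ → ℝ),
      IsOpen I ∧ I.OrdConnected ∧ I.Nonempty ∧ (∀ x ∈ I, (a n).eval x ≠ 0) ∧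
      IsAdmissibleWeight I p ∧
      ∀ u v : ℝ → ℝ, IsTestFunction u → IsTestFunction v →
        ∫ x in I, p x * diffOp n a u x * v x = ∫ x in I, p x * u x * diffOp n a v x

/-!
Let `μ` be the measure `p dx` and regard `L` as a polynomial in `D`, its symbol. The commutator of
an operator with multiplication by `x` is the formal `D`-derivative of its symbol, so the `m`-th
such derivative of `L` is symmetric for even `m` and antisymmetric for odd `m`. Testing this
against the constant `1` for `m = n, n - 1, n - 3` shows successively that `n` is even, that `μ`
satisfies the Pearson equation `(a_n μ)' = (2 / n) a_{n-1} μ`, and that `μ` satisfies a second-order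
equation in `a_{n-1}`, `a_{n-2}`, `a_{n-3}`. Eliminating `μ` between these equations leaves a
polynomial identity, whose degrees give the dichotomy.

The remaining inequalities compare `a_n` with `a_{n-1}` at infinity and at the root of `a_n`. If one
of them failed, some test function would turn the Pearson (or second-order) equation into the
integral of a function of constant sign, so `μ` would vanish on an open subset of its half-line.
The Pearson equation, whose solutions away from the root of `a_n` are determined by an integrating
factor, propagates this to `μ = 0`.
-/

/-- Every polynomial is integrable: the moments `∫ x ^ k ∂μ` are finite. -/
def HasMoments (μ : Measure ℝ) : Prop :=
  ∀ q : ℝ[X], Integrable (fun x => q.eval x) μ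

section TestFunctions

variable {μ : Measure ℝ} {u v : ℝ → ℝ}

theorem HasMoments.isFiniteMeasure (hμ : HasMoments μ) : IsFiniteMeasure μ := by
  simpa [integrable_const_iff] using hμ 1

theorem HasMoments.eq_zero_of_integral_mul_self [NullSingletonClass μ] [NeZero μ]
    (hμ : HasMoments μ) {q : ℝ[X]} (hq : ∫ x, q.eval x * q.eval x ∂μ = 0) : q = 0 := by
  have hint : Integrable (fun x => q.eval x * q.eval x) μ := by simpa using hμ (q * q)
  by_contra hq0
  have hzero : ∀ᵐ x ∂μ, q.eval x * q.eval x = 0 :=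
    (integral_eq_zero_iff_of_nonneg (fun x => mul_self_nonneg _) hint).1 hq
  have hne : ∀ᵐ x ∂μ, ¬ q.IsRoot x :=
    measure_eq_zero_iff_ae_notMem.1 ((finite_setOfPred_isRoot hq0).measure_zero μ)
  obtain ⟨x, hx, hx'⟩ := (hzero.and hne).exists
  exact hx' (mul_self_eq_zero.1 hx)

theorem contDiff_eval (q : ℝ[X]) : ContDiff ℝ ∞ fun x => q.eval x := by
  simpa using q.contDiff_aeval (𝕜 := ℝ) ∞

namespace IsTestFunction

theorem polynomial (q : ℝ[X]) : IsTestFunction fun x => q.eval x :=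
  Or.inl ⟨q, rfl⟩

theorem contDiff (hu : IsTestFunction u) : ContDiff ℝ ∞ u := by
  rcases hu with ⟨q, rfl⟩ | hu
  · exact contDiff_eval q
  · exact hu.1

theorem mul (hu : IsTestFunction u) (hv : IsTestFunction v) :
    IsTestFunction fun x => u x * v x := by
  rcases hu with ⟨q, rfl⟩ | hu
  · rcases hv with ⟨r, rfl⟩ | hv
    · exact Or.inl ⟨q * r, by simp⟩
    · exact Or.inr ⟨(contDiff_eval q).mul hv.1, hv.2.mul_left⟩
  · exact Or.inr ⟨hu.1.mul hv.contDiff, hu.2.mul_right⟩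

protected theorem deriv (hu : IsTestFunction u) : IsTestFunction (deriv u) := by
  rcases hu with ⟨q, rfl⟩ | hu
  · exact Or.inl ⟨derivative q, by ext; simp⟩
  · exact Or.inr ⟨(contDiff_infty_iff_deriv.1 hu.1).2, hu.2.deriv⟩

protected theorem iteratedDeriv (hu : IsTestFunction u) (k : ℕ) :
    IsTestFunction (iteratedDeriv k u) := by
  induction k with
  | zero => simpa using hu
  | succ k ih => simpa only [iteratedDeriv_succ] using ih.deriv

theorem integrable (hu : IsTestFunction u) (hμ : HasMoments μ) : Integrable u μ := by
  have := hμ.isFiniteMeasure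
  rcases hu with ⟨q, rfl⟩ | hu
  · exact hμ q
  · exact hu.1.continuous.integrable_of_hasCompactSupport hu.2

end IsTestFunction

end TestFunctions

/-- The differential operator `∑ k, cₖ Dᵏ` attached to its symbol `S = ∑ k, cₖ Yᵏ`, a polynomial
in an outer variable `Y` standing for `D = d/dx`, with polynomial coefficients `cₖ`. -/
noncomputable def symbolOp (S : ℝ[X][X]) (u : ℝ → ℝ) (x : ℝ) : ℝ :=
  S.sum fun k c => c.eval x * iteratedDeriv k u x

/-- The operator with symbol `S` is symmetric (`ε = 1`) or antisymmetric (`ε = -1`) in `L²(μ)`. -/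
def IsSymmWithSign (μ : Measure ℝ) (ε : ℝ) (S : ℝ[X][X]) : Prop :=
  ∀ u v : ℝ → ℝ, IsTestFunction u → IsTestFunction v →
    ∫ x, symbolOp S u x * v x ∂μ = ε * ∫ x, u x * symbolOp S v x ∂μ

section Symbols

variable {μ : Measure ℝ} {u v : ℝ → ℝ} {ε : ℝ} {S : ℝ[X][X]}

theorem symbolOp_add (S T : ℝ[X][X]) (u : ℝ → ℝ) (x : ℝ) :
    symbolOp (S + T) u x = symbolOp S u x + symbolOp T u x :=
  sum_add_index S T _ (by simp) (by simp [add_mul])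

theorem symbolOp_monomial (k : ℕ) (c : ℝ[X]) (u : ℝ → ℝ) (x : ℝ) :
    symbolOp (monomial k c) u x = c.eval x * iteratedDeriv k u x :=
  sum_monomial_index c _ (by simp)

theorem symbolOp_eq_sum_range {N : ℕ} (hS : S.natDegree < N) (u : ℝ → ℝ) (x : ℝ) :
    symbolOp S u x = ∑ k ∈ Finset.range N, (S.coeff k).eval x * iteratedDeriv k u x :=
  S.sum_over_range' (by simp) N hS

theorem diffOp_eq_symbolOp (n : ℕ) (a : ℕ → ℝ[X]) (u : ℝ → ℝ) (x : ℝ) :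
    diffOp n a u x = symbolOp (∑ k ∈ Finset.Icc 1 n, monomial k (a k)) u x := by
  let op : ℝ[X][X] →+ ℝ :=
    { toFun := fun S => symbolOp S u x
      map_zero' := by simp [symbolOp]
      map_add' := fun S T => symbolOp_add S T u x }
  change _ = op _
  rw [map_sum]
  exact Finset.sum_congr rfl fun k _ => (symbolOp_monomial k (a k) u x).symm

theorem symbolOp_one (S : ℝ[X][X]) (x : ℝ) : symbolOp S (fun _ => 1) x = (S.coeff 0).eval x := by
  rw [symbolOp_eq_sum_range (Nat.lt_succ_self _), Finset.sum_range_succ']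
  simp [iteratedDeriv_const]

theorem iteratedDeriv_id_mul (hu : ContDiff ℝ ∞ u) (k : ℕ) (x : ℝ) :
    iteratedDeriv k (fun y => y * u y) x =
      x * iteratedDeriv k u x + k * iteratedDeriv (k - 1) u x := by
  have hd (j : ℕ) (y : ℝ) : HasDerivAt (iteratedDeriv j u) (iteratedDeriv (j + 1) u y) y := by
    rw [iteratedDeriv_succ]
    exact (hu.differentiable_iteratedDeriv j (mod_cast WithTop.coe_lt_top _) y).hasDerivAt
  induction k generalizing x with
  | zero => simp
  | succ k ih =>
    rw [iteratedDeriv_succ, funext ih]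
    refine (((hasDerivAt_id x).mul (hd k x)).add ((hd (k - 1) x).const_mul (k : ℝ))).deriv.trans ?_
    rcases k with _ | k
    · simp [add_comm]
    · simp only [id_eq, Nat.cast_add, Nat.cast_one, Nat.add_sub_cancel]
      ring

theorem symbolOp_derivative (S : ℝ[X][X]) (hu : ContDiff ℝ ∞ u) (x : ℝ) :
    symbolOp (derivative S) u x = symbolOp S (fun y => y * u y) x - x * symbolOp S u x := by
  induction S using Polynomial.induction_on' with
  | add S T hS hT =>
    rw [derivative_add, symbolOp_add, symbolOp_add, symbolOp_add, hS, hT]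
    ring
  | monomial k c =>
    rw [derivative_monomial, symbolOp_monomial, symbolOp_monomial, symbolOp_monomial,
      iteratedDeriv_id_mul hu, eval_mul, eval_natCast]
    ring

theorem IsTestFunction.integrable_symbolOp_mul (hu : IsTestFunction u) (hv : IsTestFunction v)
    (hμ : HasMoments μ) (S : ℝ[X][X]) : Integrable (fun x => symbolOp S u x * v x) μ := by
  simp only [symbolOp, Polynomial.sum, Finset.sum_mul]
  exact integrable_finsetSum _ fun k _ =>
    (((IsTestFunction.polynomial _).mul (hu.iteratedDeriv k)).mul hv).integrable hμ

namespace IsSymmWithSign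

protected theorem derivative (hS : IsSymmWithSign μ ε S) (hμ : HasMoments μ) :
    IsSymmWithSign μ (-ε) (derivative S) := by
  intro u v hu hv
  have hX : IsTestFunction fun x => x := by simpa using IsTestFunction.polynomial X
  have hxu := hX.mul hu
  have hxv := hX.mul hv
  calc ∫ x, symbolOp (derivative S) u x * v x ∂μ
      = ∫ x, symbolOp S (fun y => y * u y) x * v x - symbolOp S u x * (x * v x) ∂μ := by
        simp only [symbolOp_derivative S hu.contDiff]
        congr with x
        ring
    _ = ε * ((∫ x, x * u x * symbolOp S v x ∂μ) -
          ∫ x, u x * symbolOp S (fun y => y * v y) x ∂μ) := by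
        rw [integral_sub (hxu.integrable_symbolOp_mul hv hμ S)
          (hu.integrable_symbolOp_mul hxv hμ S), hS _ _ hxu hv, hS _ _ hu hxv, mul_sub]
    _ = ε * ∫ x, symbolOp S v x * (x * u x) - symbolOp S (fun y => y * v y) x * u x ∂μ := by
        rw [integral_sub (hv.integrable_symbolOp_mul hxu hμ S)
          (hxv.integrable_symbolOp_mul hu hμ S)]
        simp only [mul_comm]
    _ = -ε * ∫ x, u x * symbolOp (derivative S) v x ∂μ := by
        rw [neg_mul, ← mul_neg, ← integral_neg]
        simp only [symbolOp_derivative S hv.contDiff]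
        congr with x
        ring

theorem iterate_derivative (hS : IsSymmWithSign μ 1 S) (hμ : HasMoments μ) (m : ℕ) :
    IsSymmWithSign μ ((-1) ^ m) (derivative^[m] S) := by
  induction m with
  | zero => simpa using hS
  | succ m ih =>
    rw [Function.iterate_succ_apply', pow_succ, mul_neg_one]
    exact ih.derivative hμ

theorem integral_symbolOp (hS : IsSymmWithSign μ ε S) (hu : IsTestFunction u) :
    ∫ x, symbolOp S u x ∂μ = ε * ∫ x, (S.coeff 0).eval x * u x ∂μ := by
  have hone : IsTestFunction fun _ => 1 := by simpa using IsTestFunction.polynomial 1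
  simpa [symbolOp_one, mul_comm] using hS u _ hu hone

end IsSymmWithSign

end Symbols

/-- The distributional Pearson equation `(φ μ)' = ψ μ`, tested against the class of
`IsTestFunction`. -/
def IsPearson (μ : Measure ℝ) (φ ψ : ℝ[X]) : Prop :=
  ∀ u : ℝ → ℝ, IsTestFunction u → ∫ x, φ.eval x * deriv u x + ψ.eval x * u x ∂μ = 0

/-- The distributional equation `(f μ)'' - (g μ)' + h μ = 0`, tested against the class of
`IsTestFunction`. -/
def IsSecondOrderPearson (μ : Measure ℝ) (f g h : ℝ[X]) : Prop :=
  ∀ u : ℝ → ℝ, IsTestFunction u →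
    ∫ x, f.eval x * iteratedDeriv 2 u x + g.eval x * deriv u x + h.eval x * u x ∂μ = 0

section Commutators

variable {μ : Measure ℝ} {S : ℝ[X][X]} {m : ℕ}

theorem symbolOp_iterate_derivative {N : ℕ} (hdeg : S.natDegree = m + N) (u : ℝ → ℝ) (x : ℝ) :
    symbolOp (derivative^[m] S) u x = m.factorial * ∑ j ∈ Finset.range (N + 1),
      ((m + j).choose m : ℝ) * ((S.coeff (m + j)).eval x * iteratedDeriv j u x) := by
  have hlt : (derivative^[m] S).natDegree < N + 1 := by
    have := natDegree_iterate_derivative S m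
    omega
  rw [symbolOp_eq_sum_range hlt, Finset.mul_sum]
  refine Finset.sum_congr rfl fun j _ => ?_
  rw [coeff_iterate_derivative, add_comm j m, Nat.descFactorial_eq_factorial_mul_choose,
    nsmul_eq_mul, eval_mul, eval_natCast, Nat.cast_mul]
  ring

theorem IsTestFunction.integrable_eval_mul_iteratedDeriv {u : ℝ → ℝ} (hu : IsTestFunction u)
    (hμ : HasMoments μ) (q : ℝ[X]) (k : ℕ) :
    Integrable (fun x => q.eval x * iteratedDeriv k u x) μ :=
  ((IsTestFunction.polynomial q).mul (hu.iteratedDeriv k)).integrable hμ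

namespace IsSymmWithSign

theorem sum_choose_mul_integral (hS : IsSymmWithSign μ 1 S) (hμ : HasMoments μ) {N : ℕ}
    (hdeg : S.natDegree = m + N) {u : ℝ → ℝ} (hu : IsTestFunction u) :
    ∑ j ∈ Finset.range (N + 1),
        ((m + j).choose m : ℝ) * ∫ x, (S.coeff (m + j)).eval x * iteratedDeriv j u x ∂μ =
      (-1) ^ m * ∫ x, (S.coeff m).eval x * u x ∂μ := by
  have h := (hS.iterate_derivative hμ m).integral_symbolOp hu
  simp only [symbolOp_iterate_derivative hdeg, coeff_iterate_derivative, zero_add, nsmul_eq_mul,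
    Nat.descFactorial_self, eval_mul, eval_natCast, mul_assoc, integral_const_mul] at h
  rw [integral_finsetSum _ fun j _ =>
    (hu.integrable_eval_mul_iteratedDeriv hμ _ j).const_mul _] at h
  simp only [integral_const_mul] at h
  exact mul_left_cancel₀ (Nat.cast_ne_zero.2 m.factorial_ne_zero) (h.trans (mul_left_comm _ _ _))

variable [NullSingletonClass μ] [NeZero μ]

theorem even_natDegree (hS : IsSymmWithSign μ 1 S) (hμ : HasMoments μ)
    (hS0 : S ≠ 0) : Even S.natDegree := by
  by_contra hodd
  have h := hS.sum_choose_mul_integral hμ (m := S.natDegree) (N := 0) rfl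
    (.polynomial S.leadingCoeff)
  simp only [zero_add, Finset.range_one, Finset.sum_singleton, add_zero, Nat.choose_self,
    Nat.cast_one, one_mul, iteratedDeriv_zero, coeff_natDegree,
    (Nat.not_even_iff_odd.1 hodd).neg_one_pow] at h
  exact hS0 (leadingCoeff_eq_zero.1 (hμ.eq_zero_of_integral_mul_self (by linarith)))

theorem isPearson (hS : IsSymmWithSign μ 1 S) (hμ : HasMoments μ) (hdeg : S.natDegree = m + 1) :
    IsPearson μ (S.coeff (m + 1)) (C (2 / (m + 1) : ℝ) * S.coeff m) := by
  intro u hu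
  have hodd : Odd m := by
    have := hS.even_natDegree hμ (ne_zero_of_natDegree_gt (n := 0) (by omega))
    grind
  have h := hS.sum_choose_mul_integral hμ hdeg hu
  have hint := hu.integrable_eval_mul_iteratedDeriv hμ
  simp only [Finset.sum_range_succ, Finset.sum_range_zero, zero_add, add_zero, Nat.choose_self,
    Nat.choose_succ_self_right, hodd.neg_one_pow, iteratedDeriv_zero, Nat.cast_one,
    Nat.cast_add] at h
  simp only [eval_mul, eval_C, mul_assoc, ← iteratedDeriv_one]
  have h0 : Integrable (fun x => (S.coeff m).eval x * u x) μ := hint (S.coeff m) 0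
  rw [integral_add (hint _ 1) (h0.const_mul _), integral_const_mul]
  have hm : (m + 1 : ℝ) ≠ 0 := by positivity
  field_simp
  linear_combination h

theorem isSecondOrderPearson (hS : IsSymmWithSign μ 1 S) (hμ : HasMoments μ)
    (hdeg : S.natDegree = m + 3) :
    IsSecondOrderPearson μ (C ((m + 1) * (m + 2) / 6 : ℝ) * S.coeff (m + 2))
      (C (m + 1 : ℝ) * S.coeff (m + 1)) (2 * S.coeff m) := by
  intro u hu
  have hodd : Odd m := by
    have := hS.even_natDegree hμ (ne_zero_of_natDegree_gt (n := 0) (by omega))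
    grind
  have h := hS.sum_choose_mul_integral hμ hdeg hu
  have hint := hu.integrable_eval_mul_iteratedDeriv hμ
  have hPearson := hS.isPearson hμ hdeg _ (hu.iteratedDeriv 2)
  simp only [eval_mul, eval_C, mul_assoc, ← iteratedDeriv_succ] at hPearson
  rw [integral_add (hint _ 3) ((hint _ 2).const_mul _), integral_const_mul] at hPearson
  have hchoose2 : ((m + 2).choose m : ℝ) = (m + 1) * (m + 2) / 2 := by
    rw [Nat.cast_add_choose]
    push_cast [Nat.factorial]
    field_simp
    ring
  have hchoose3 : ((m + 3).choose m : ℝ) = (m + 1) * (m + 2) * (m + 3) / 6 := by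
    rw [Nat.cast_add_choose]
    push_cast [Nat.factorial]
    field_simp
    ring
  simp only [Finset.sum_range_succ, Finset.sum_range_zero, zero_add, add_zero, Nat.choose_self,
    Nat.choose_succ_self_right, hodd.neg_one_pow, Nat.cast_one, one_mul, iteratedDeriv_zero,
    hchoose2, hchoose3] at h
  simp only [eval_mul, eval_C, eval_ofNat, mul_assoc, ← iteratedDeriv_one]
  have h0 : Integrable (fun x => (S.coeff m).eval x * u x) μ := hint (S.coeff m) 0
  have h1 := (hint (S.coeff (m + 1)) 1).const_mul (m + 1 : ℝ)
  have h2 := (hint (S.coeff (m + 2)) 2).const_mul ((m + 1) * (m + 2) / 6 : ℝ)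
  rw [integral_add (by exact h2.add h1) (h0.const_mul 2), integral_add h2 h1, integral_const_mul,
    integral_const_mul, integral_const_mul]
  have hm : (m + 2 + 1 : ℝ) ≠ 0 := by positivity
  push_cast at h hPearson
  field_simp at hPearson
  linear_combination h - (m + 1) * (m + 2) / 6 * hPearson

end IsSymmWithSign

end Commutators

section Flux

variable {R : Type*} [CommRing R] {φ ψ f g h : R[X]}

/-- The polynomial `Q` through which the second-order equation with coefficients `f, g, h`, reduced
modulo the Pearson equation `(φ μ)' = ψ μ`, becomes the first-order equation `(φ Q μ)' = …`. -/
noncomputable def flux (φ ψ f g : R[X]) : R[X] :=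
  φ * (g - derivative f) + (derivative φ - ψ) * f

theorem flux_relation {M : Type*} [AddCommGroup M] (Λ : R[X] →+ M)
    (hdef : ∀ q, Λ (q * q) = 0 → q = 0)
    (hPearson : ∀ q, Λ (φ * derivative q + ψ * q) = 0)
    (hSecond : ∀ q, Λ (f * derivative (derivative q) + g * derivative q + h * q) = 0) :
    φ * derivative (flux φ ψ f g) + (ψ - 2 * derivative φ) * flux φ ψ f g = h * φ ^ 2 := by
  suffices hweak : ∀ y, Λ ((φ * derivative (flux φ ψ f g) +
      (ψ - 2 * derivative φ) * flux φ ψ f g - h * φ ^ 2) * y) = 0 from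
    sub_eq_zero.1 (hdef _ (hweak _))
  intro y
  -- `φ * φ * y` is chosen so that its derivative `φ * q` is again divisible by `φ`
  let q := 2 * derivative φ * y + φ * derivative y
  have hsplit : (φ * derivative (flux φ ψ f g) +
      (ψ - 2 * derivative φ) * flux φ ψ f g - h * φ ^ 2) * y =
      (φ * derivative (f * q) + ψ * (f * q)) +
        (φ * derivative (flux φ ψ f g * y) + ψ * (flux φ ψ f g * y)) -
        (f * derivative (derivative (φ * φ * y)) + g * derivative (φ * φ * y) +
          h * (φ * φ * y)) := by
    simp only [q, flux, derivative_mul, derivative_add, derivative_sub,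
      derivative_ofNat]
    ring
  rw [hsplit, map_sub, map_add, hPearson, hPearson, hSecond, add_zero, sub_zero]

theorem three_mul_natDegree_le_of_flux_relation [IsDomain R]
    (hflux : φ * derivative (flux φ ψ f g) + (ψ - 2 * derivative φ) * flux φ ψ f g = h * φ ^ 2)
    (hf : f.natDegree = ψ.natDegree) (hφ : φ.natDegree ≤ ψ.natDegree)
    (hg : φ.natDegree + g.natDegree < 2 * ψ.natDegree) :
    3 * ψ.natDegree ≤ h.natDegree + 2 * φ.natDegree := by
  have hψ0 : ψ ≠ 0 := ne_zero_of_natDegree_gt (n := 0) (by omega)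
  have hf0 : f ≠ 0 := ne_zero_of_natDegree_gt (n := 0) (by omega)
  have hφ' := natDegree_derivative_le φ
  have hf' := natDegree_derivative_le f
  have hψf : (ψ * f).natDegree = 2 * ψ.natDegree := by
    rw [natDegree_mul hψ0 hf0, hf, two_mul]
  have hQ : (flux φ ψ f g).natDegree = 2 * ψ.natDegree := by
    have hlow : (φ * (g - derivative f) + derivative φ * f).natDegree < (ψ * f).natDegree := by
      have h1 := natDegree_mul_le (p := φ) (q := g - derivative f)
      have h2 := natDegree_sub_le g (derivative f)
      have h3 := natDegree_mul_le (p := derivative φ) (q := f)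
      have h4 := natDegree_add_le (φ * (g - derivative f)) (derivative φ * f)
      omega
    rw [flux, sub_mul, add_sub_assoc', natDegree_sub_eq_right_of_natDegree_lt hlow, hψf]
  have hQ0 : flux φ ψ f g ≠ 0 := ne_zero_of_natDegree_gt (n := 0) (by omega)
  have hcoeff : (ψ - 2 * derivative φ).natDegree = ψ.natDegree := by
    refine natDegree_sub_eq_left_of_natDegree_lt ?_
    have h1 := natDegree_mul_le (p := 2) (q := derivative φ)
    rw [natDegree_ofNat] at h1
    omega
  have hcoeff0 : ψ - 2 * derivative φ ≠ 0 := ne_zero_of_natDegree_gt (n := 0) (by omega)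
  have hlead : ((ψ - 2 * derivative φ) * flux φ ψ f g).natDegree = 3 * ψ.natDegree := by
    rw [natDegree_mul hcoeff0 hQ0, hcoeff, hQ]
    ring
  calc 3 * ψ.natDegree
      = (φ * derivative (flux φ ψ f g) + (ψ - 2 * derivative φ) * flux φ ψ f g).natDegree := by
        rw [natDegree_add_eq_right_of_natDegree_lt ?_, hlead]
        have h1 := natDegree_mul_le (p := φ) (q := derivative (flux φ ψ f g))
        have h2 := natDegree_derivative_le (flux φ ψ f g)
        omega
    _ = (h * φ ^ 2).natDegree := by rw [hflux]
    _ ≤ h.natDegree + 2 * φ.natDegree :=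
        natDegree_mul_le.trans (by gcongr; exact natDegree_pow_le)

end Flux

section FluxOfMeasure

variable {μ : Measure ℝ}

/-- The functional `q ↦ ∫ q ∂μ` on polynomials. -/
noncomputable def HasMoments.functional (hμ : HasMoments μ) : ℝ[X] →+ ℝ where
  toFun q := ∫ x, q.eval x ∂μ
  map_zero' := by simp
  map_add' p q := by simpa using integral_add (hμ p) (hμ q)

theorem IsSecondOrderPearson.flux_relation [NullSingletonClass μ] [NeZero μ] {φ ψ f g h : ℝ[X]}
    (hSecond : IsSecondOrderPearson μ f g h) (hμ : HasMoments μ) (hPearson : IsPearson μ φ ψ) :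
    φ * derivative (flux φ ψ f g) + (ψ - 2 * derivative φ) * flux φ ψ f g = h * φ ^ 2 := by
  refine _root_.flux_relation hμ.functional (fun q hq => ?_) (fun q => ?_) (fun q => ?_)
  · exact hμ.eq_zero_of_integral_mul_self (by simpa [HasMoments.functional] using hq)
  · simpa [HasMoments.functional] using hPearson _ (.polynomial q)
  · have hderiv (p : ℝ[X]) : deriv (fun x => p.eval x) = fun x => (derivative p).eval x :=
      funext fun x => p.deriv
    simpa [HasMoments.functional, iteratedDeriv_succ, hderiv] using hSecond _ (.polynomial q)

end FluxOfMeasure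

section Sign

open Set Filter
open scoped Topology

variable {μ : Measure ℝ}

theorem measure_eq_zero_of_integral_eq_zero {F : ℝ → ℝ} {U : Set ℝ} (hF : Integrable F μ)
    (hcont : Continuous F) (hU : IsPreconnected U) (hne : ∀ x ∈ U, F x ≠ 0)
    (hoff : ∀ᵐ x ∂μ, x ∉ U → F x = 0) (hint : ∫ x, F x ∂μ = 0) : μ U = 0 := by
  have habs : ∫ x, |F x| ∂μ = 0 := by
    have hsign := hU.eq_or_eq_neg_of_sq_eq hcont.continuousOn hcont.abs.continuousOn
      (fun x _ => (sq_abs (F x)).symm) fun {x} hx => abs_ne_zero.2 (hne x hx)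
    rcases hsign with hpos | hneg
    · rw [← hint]
      refine integral_congr_ae ?_
      filter_upwards [hoff] with x hx
      by_cases hxU : x ∈ U
      · exact (hpos hxU).symm
      · simp [hx hxU]
    · rw [← neg_eq_zero, ← integral_neg, ← hint]
      refine integral_congr_ae ?_
      filter_upwards [hoff] with x hx
      by_cases hxU : x ∈ U
      · exact (hneg hxU).symm
      · simp [hx hxU]
  rw [measure_eq_zero_iff_ae_notMem]
  filter_upwards [(integral_eq_zero_iff_of_nonneg (fun x => abs_nonneg _) hF.abs).1 habs]
    with x hx hxU
  exact hne x hxU (abs_eq_zero.1 hx)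

/-- The open half-line issuing from `r` in the direction of the sign of `σ`. -/
def ray (σ r : ℝ) : Set ℝ :=
  {x | 0 < σ * (x - r)}

theorem ray_one (r : ℝ) : ray 1 r = Ioi r := by
  ext; simp [ray]

theorem ray_neg_one (r : ℝ) : ray (-1) r = Iio r := by
  ext; simp [ray]

theorem exists_measure_ray_neg_eq_zero {r : ℝ} (h : μ (Iio r) = 0 ∨ μ (Ioi r) = 0) :
    ∃ σ ≠ 0, μ (ray (-σ) r) = 0 := by
  rcases h with h | h
  · exact ⟨1, one_ne_zero, by rwa [ray_neg_one]⟩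
  · exact ⟨-1, by norm_num, by rwa [neg_neg, ray_one]⟩

theorem isOpen_ray (σ r : ℝ) : IsOpen (ray σ r) :=
  isOpen_lt continuous_const (by fun_prop)

theorem ordConnected_ray (σ r : ℝ) : (ray σ r).OrdConnected := by
  refine ⟨fun x hx y hy z hz => ?_⟩
  obtain ⟨hxz, hzy⟩ := hz
  simp only [ray, mem_ofPred_eq] at *
  rcases le_total 0 σ with hσ | hσ <;> nlinarith

theorem isPreconnected_ray_inter (σ r τ s : ℝ) : IsPreconnected (ray σ r ∩ ray τ s) :=
  ((ordConnected_ray σ r).inter (ordConnected_ray τ s)).isPreconnected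

theorem ray_inter_subset_uIcc {σ s t y : ℝ} (hst : t ∈ ray σ s) :
    ray σ t ∩ ray (-σ) y ⊆ uIcc s y := by
  rintro x ⟨hxt, hxy⟩
  simp only [ray, mem_ofPred_eq, mul_pos_iff, mem_uIcc] at *
  grind

theorem exists_mem_ray_dist_lt {σ : ℝ} (hσ : σ ≠ 0) (r : ℝ) {δ : ℝ} (hδ : 0 < δ) :
    ∃ y ∈ ray σ r, dist y r < δ := by
  refine ⟨r + δ / (2 * σ) * |σ|, ?_, ?_⟩
  · have : 0 < δ / 2 * |σ| := by positivity
    simp only [ray, mem_ofPred_eq]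
    convert this using 1
    field_simp
    ring
  · rw [Real.dist_eq, add_sub_cancel_left, abs_mul, abs_div, abs_mul, abs_abs, abs_of_pos hδ,
      abs_two, ← div_div, div_mul_cancel₀ _ (abs_pos.2 hσ).ne']
    exact half_lt_self hδ

theorem ray_inter_ray_nonempty {σ : ℝ} (hσ : σ ≠ 0) (y r : ℝ) : (ray σ y ∩ ray σ r).Nonempty := by
  refine ⟨(max (σ * y) (σ * r) + 1) / σ, ?_⟩
  simp only [ray, mem_inter_iff, mem_ofPred_eq, mul_sub, mul_div_cancel₀ _ hσ]
  grind

theorem measure_ray_ne_zero [NullSingletonClass μ] [NeZero μ] {σ r : ℝ} (hσ : σ ≠ 0)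
    (hnull : μ (ray (-σ) r) = 0) : μ (ray σ r) ≠ 0 := by
  intro h
  refine NeZero.ne (μ univ) (measure_mono_null (fun x _ => ?_)
    (measure_union_null (measure_union_null h hnull) (measure_singleton r)))
  rcases lt_trichotomy 0 (σ * (x - r)) with hx | hx | hx
  · exact .inl (.inl hx)
  · exact .inr (sub_eq_zero.1 ((mul_eq_zero.1 hx.symm).resolve_left hσ))
  · exact .inl (.inr (by simpa [ray] using hx))

end Sign

section EdgeBump

open Set Filter
open scoped Topology

variable {μ : Measure ℝ} {σ s t y x : ℝ}

/-- A bump supported between `s` and `y` which, from `t` on in the direction of `σ`, equals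
`exp (-1 / (σ * (y - x)))`: near the edge `y` its higher derivatives dominate the lower ones. -/
noncomputable def edgeBump (σ s t y x : ℝ) : ℝ :=
  Real.smoothTransition ((x - s) / (t - s)) * expNegInvGlue (σ * (y - x))

theorem contDiff_edgeBump : ContDiff ℝ ∞ (edgeBump σ s t y) :=
  (Real.smoothTransition.contDiff.comp (by fun_prop)).mul
    (expNegInvGlue.contDiff.comp (by fun_prop))

theorem tsupport_edgeBump_subset (hst : t ∈ ray σ s) : tsupport (edgeBump σ s t y) ⊆ uIcc s y := by
  refine closure_minimal (fun x hx => ?_) isClosed_Icc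
  obtain ⟨hxs, hxy⟩ := mul_ne_zero_iff.1 hx
  have hxs' : 0 < (x - s) / (t - s) := by
    contrapose! hxs
    exact Real.smoothTransition.zero_of_nonpos hxs
  have hxy' : 0 < σ * (y - x) := by
    contrapose! hxy
    exact expNegInvGlue.zero_of_nonpos hxy
  simp only [ray, mem_ofPred_eq, mul_pos_iff, div_pos_iff] at *
  grind [mem_uIcc]

theorem isTestFunction_edgeBump (hst : t ∈ ray σ s) : IsTestFunction (edgeBump σ s t y) :=
  .inr ⟨contDiff_edgeBump, isCompact_uIcc.of_isClosed_subset (isClosed_tsupport _)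
    (tsupport_edgeBump_subset hst)⟩

theorem edgeBump_eventuallyEq (hst : t ∈ ray σ s) (hx : x ∈ ray σ t) :
    edgeBump σ s t y =ᶠ[𝓝 x] fun z => expNegInvGlue (σ * (y - z)) := by
  filter_upwards [(isOpen_ray σ t).mem_nhds hx] with z hz
  have hz1 : 1 ≤ (z - s) / (t - s) := by
    simp only [ray, mem_ofPred_eq, mul_pos_iff] at hst hz
    rcases hst with ⟨hσ, hst⟩ | ⟨hσ, hst⟩
    · rw [one_le_div hst]; grind
    · rw [one_le_div_of_neg hst]; grind
  rw [edgeBump, Real.smoothTransition.one_of_one_le hz1, one_mul]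

theorem ae_edgeBump_eventuallyEq_zero [NullSingletonClass μ] (hst : t ∈ ray σ s)
    (hty : y ∈ ray σ t) (hnull : μ (ray σ s ∩ ray (-σ) t) = 0) :
    ∀ᵐ x ∂μ, x ∉ ray σ t ∩ ray (-σ) y → edgeBump σ s t y =ᶠ[𝓝 x] 0 := by
  filter_upwards [measure_eq_zero_iff_ae_notMem.1 hnull, Measure.ae_ne μ s, Measure.ae_ne μ t,
    Measure.ae_ne μ y] with x hx hxs hxt hxy hxU
  refine notMem_tsupport_iff_eventuallyEq.1 fun hxsupp => ?_
  have hxI := mem_uIcc.1 (tsupport_edgeBump_subset hst hxsupp)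
  clear hnull hxsupp
  simp only [ray, mem_inter_iff, mem_ofPred_eq, mul_pos_iff] at *
  grind

theorem hasDerivAt_expNegInvGlue (x : ℝ) :
    HasDerivAt expNegInvGlue (x⁻¹ ^ 2 * expNegInvGlue x) x := by
  simpa using expNegInvGlue.hasDerivAt_polynomial_eval_inv_mul 1 x

theorem hasDerivAt_inv_sq_mul_expNegInvGlue (x : ℝ) :
    HasDerivAt (fun x => x⁻¹ ^ 2 * expNegInvGlue x)
      ((x⁻¹ ^ 4 - 2 * x⁻¹ ^ 3) * expNegInvGlue x) x := by
  have h := expNegInvGlue.hasDerivAt_polynomial_eval_inv_mul (X ^ 2) x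
  simp only [eval_pow, eval_X, derivative_X_pow, eval_mul, eval_sub, eval_C, Nat.cast_ofNat] at h
  convert h using 2
  ring

theorem deriv_edgeBump (hst : t ∈ ray σ s) (hx : x ∈ ray σ t) :
    deriv (edgeBump σ s t y) x =
      -σ * ((σ * (y - x))⁻¹ ^ 2 * expNegInvGlue (σ * (y - x))) := by
  rw [(edgeBump_eventuallyEq hst hx).deriv_eq]
  have hlin : HasDerivAt (fun z => σ * (y - z)) (-σ) x := by
    simpa using ((hasDerivAt_id x).const_sub y).const_mul σ
  exact ((hasDerivAt_expNegInvGlue _).comp x hlin).deriv.trans (mul_comm _ _)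

theorem iteratedDeriv_two_edgeBump (hst : t ∈ ray σ s) (hx : x ∈ ray σ t) :
    iteratedDeriv 2 (edgeBump σ s t y) x =
      σ ^ 2 * (((σ * (y - x))⁻¹ ^ 4 - 2 * (σ * (y - x))⁻¹ ^ 3) *
        expNegInvGlue (σ * (y - x))) := by
  have hfirst : deriv (edgeBump σ s t y) =ᶠ[𝓝 x] fun z =>
      -σ * ((σ * (y - z))⁻¹ ^ 2 * expNegInvGlue (σ * (y - z))) :=
    Filter.mem_of_superset ((isOpen_ray σ t).mem_nhds hx) fun z hz => deriv_edgeBump hst hz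
  have hlin : HasDerivAt (fun z => σ * (y - z)) (-σ) x := by
    simpa using ((hasDerivAt_id x).const_sub y).const_mul σ
  rw [iteratedDeriv_succ, iteratedDeriv_one, hfirst.deriv_eq]
  refine (((hasDerivAt_inv_sq_mul_expNegInvGlue _).comp x hlin).const_mul (-σ)).deriv.trans ?_
  ring

theorem secondOrder_edgeBump (f g h : ℝ) (hst : t ∈ ray σ s) (hx : x ∈ ray σ t)
    (hxy : 0 < σ * (y - x)) :
    f * iteratedDeriv 2 (edgeBump σ s t y) x + g * deriv (edgeBump σ s t y) x +
        h * edgeBump σ s t y x =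
      (σ * (y - x))⁻¹ ^ 4 * expNegInvGlue (σ * (y - x)) *
        (σ ^ 2 * f * (1 - 2 * (σ * (y - x))) - σ * g * (σ * (y - x)) ^ 2 +
          h * (σ * (y - x)) ^ 4) := by
  rw [iteratedDeriv_two_edgeBump hst hx, deriv_edgeBump hst hx,
    (edgeBump_eventuallyEq hst hx).eq_of_nhds]
  generalize σ * (y - x) = τ at hxy ⊢
  field_simp
  ring

end EdgeBump

section NullSets

open Set Filter
open scoped Topology

variable {μ : Measure ℝ} {σ r : ℝ}

theorem IsSecondOrderPearson.exists_null_ray_inter [NullSingletonClass μ] {f g h : ℝ[X]}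
    (hsecond : IsSecondOrderPearson μ f g h) (hμ : HasMoments μ) (hσ : σ ≠ 0)
    (hnull : μ (ray (-σ) r) = 0) (hf : f.eval r ≠ 0) :
    ∃ y ∈ ray σ r, μ (ray σ r ∩ ray (-σ) y) = 0 := by
  let B : ℝ × ℝ → ℝ := fun z => σ ^ 2 * f.eval z.1 * (1 - 2 * (σ * (z.2 - z.1))) -
    σ * g.eval z.1 * (σ * (z.2 - z.1)) ^ 2 + h.eval z.1 * (σ * (z.2 - z.1)) ^ 4
  have hB : ∀ᶠ z in 𝓝 r ×ˢ 𝓝 r, B z ≠ 0 := by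
    rw [← nhds_prod_eq]
    refine ContinuousAt.eventually_ne (Continuous.continuousAt ?_) (by simp [B, hσ, hf])
    simp only [B]
    fun_prop
  obtain ⟨V, hV, hBV⟩ := eventually_prod_self_iff'.1 hB
  obtain ⟨δ, hδ, hδV⟩ := Metric.mem_nhds_iff.1 hV
  obtain ⟨y, hy, hyδ⟩ := exists_mem_ray_dist_lt hσ r hδ
  obtain ⟨s, hs⟩ : ∃ s, r ∈ ray σ s := ⟨r - σ, by simpa [ray] using mul_self_pos.2 hσ⟩
  refine ⟨y, hy, ?_⟩
  have hu : IsTestFunction (edgeBump σ s r y) := isTestFunction_edgeBump hs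
  refine measure_eq_zero_of_integral_eq_zero ?_ ?_ (isPreconnected_ray_inter _ _ _ _) ?_ ?_
    (hsecond _ hu)
  · exact ((((IsTestFunction.polynomial f).mul (hu.iteratedDeriv 2)).integrable hμ).add
      (((IsTestFunction.polynomial g).mul hu.deriv).integrable hμ)).add
      (((IsTestFunction.polynomial h).mul hu).integrable hμ)
  · have h0 := hu.contDiff.continuous
    have h1 := hu.deriv.contDiff.continuous
    have h2 := (hu.iteratedDeriv 2).contDiff.continuous
    fun_prop
  · rintro x ⟨hx, hxy⟩
    have hτ : 0 < σ * (y - x) := by simpa [ray, mul_sub] using hxy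
    have hxr : dist x r < δ := by
      refine lt_trans ?_ hyδ
      simp only [ray, mem_ofPred_eq, mul_pos_iff] at hx hτ
      rw [Real.dist_eq, Real.dist_eq]
      grind
    rw [secondOrder_edgeBump _ _ _ hs hx hτ]
    exact mul_ne_zero (mul_ne_zero (pow_ne_zero 4 (inv_ne_zero hτ.ne'))
      (expNegInvGlue.pos_of_pos hτ).ne') (hBV x (hδV hxr) y (hδV hyδ))
  · filter_upwards [ae_edgeBump_eventuallyEq_zero hs hy
      (measure_mono_null inter_subset_right hnull)] with x hx hxU
    simp [(hx hxU).eq_of_nhds, (hx hxU).deriv_eq, (hx hxU).iteratedDeriv_eq 2]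

end NullSets

section UniqueContinuation

open Set Filter
open scoped Topology

variable {μ : Measure ℝ} {J : Set ℝ} {φ ψ u v : ℝ[X]} {σ s t y : ℝ}

theorem exists_integrating_factor (hJo : IsOpen J) (hJ : J.OrdConnected) {h : ℝ → ℝ}
    (hh : ContDiffOn ℝ ∞ h J) :
    ∃ M : ℝ → ℝ, ContDiffOn ℝ ∞ M J ∧ (∀ x, 0 < M x) ∧ ∀ x ∈ J, HasDerivAt M (h x * M x) x := by
  rcases J.eq_empty_or_nonempty with rfl | ⟨x₀, hx₀⟩
  · exact ⟨1, contDiffOn_const, by simp, by simp⟩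
  have hderiv : ∀ x ∈ J, HasDerivAt (fun x => ∫ t in x₀..x, h t) (h x) x := fun x hx =>
    intervalIntegral.integral_hasDerivAt_right
      (hh.continuousOn.mono (hJ.uIcc_subset hx₀ hx)).intervalIntegrable
      (hh.continuousOn.stronglyMeasurableAtFilter hJo x hx)
      (hh.continuousOn.continuousAt (hJo.mem_nhds hx))
  have hsmooth : ContDiffOn ℝ ∞ (fun x => ∫ t in x₀..x, h t) J :=
    (contDiffOn_infty_iff_deriv_of_isOpen hJo).2
      ⟨fun x hx => (hderiv x hx).differentiableAt.differentiableWithinAt,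
        hh.congr fun x hx => (hderiv x hx).deriv⟩
  refine ⟨fun x => Real.exp (∫ t in x₀..x, h t), hsmooth.exp, fun x => Real.exp_pos _,
    fun x hx => ?_⟩
  rw [mul_comm]
  exact (hderiv x hx).exp

theorem isTestFunction_mul_edgeBump (hJo : IsOpen J) (hJ : J.OrdConnected) {M : ℝ → ℝ}
    (hM : ContDiffOn ℝ ∞ M J) (hs : s ∈ J) (hy : y ∈ J) (hst : t ∈ ray σ s) :
    IsTestFunction (fun x => M x * edgeBump σ s t y x) := by
  have hsub : tsupport (fun x => M x * edgeBump σ s t y x) ⊆ uIcc s y :=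
    (tsupport_mul_subset_right ..).trans (tsupport_edgeBump_subset hst)
  refine .inr ⟨contDiff_iff_contDiffAt.2 fun x => ?_,
    isCompact_uIcc.of_isClosed_subset (isClosed_tsupport _) hsub⟩
  by_cases hx : x ∈ J
  · exact (hM.contDiffAt (hJo.mem_nhds hx)).mul contDiff_edgeBump.contDiffAt
  · exact contDiffAt_const.congr_of_eventuallyEq
      (notMem_tsupport_iff_eventuallyEq.1 fun h => hx (hJ.uIcc_subset hs hy (hsub h)))

theorem IsPearson.measure_ray_inter_eq_zero [NullSingletonClass μ] (hP : IsPearson μ φ ψ)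
    (hμ : HasMoments μ) (hJo : IsOpen J) (hJ : J.OrdConnected) (hu : ∀ x ∈ J, u.eval x ≠ 0)
    (hode : φ * v = ψ * u) (hs : s ∈ J) (hy : y ∈ J) (hst : t ∈ ray σ s) (hty : y ∈ ray σ t)
    (hnull : μ (ray σ s ∩ ray (-σ) t) = 0)
    (hφ : ∀ x ∈ ray σ t ∩ ray (-σ) y, φ.eval x ≠ 0) : μ (ray σ t ∩ ray (-σ) y) = 0 := by
  -- The integrating factor `M` solves `φ M' + ψ M = 0`, so testing against `M χ` leaves `φ M χ'`.
  obtain ⟨M, hM, hMpos, hMderiv⟩ := exists_integrating_factor (h := fun x => -(v.eval x / u.eval x))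
    hJo hJ ((contDiff_eval v).contDiffOn.div (contDiff_eval u).contDiffOn hu).neg
  have hw := isTestFunction_mul_edgeBump hJo hJ hM hs hy hst
  refine measure_eq_zero_of_integral_eq_zero ?_ ?_ (isPreconnected_ray_inter _ _ _ _) ?_ ?_
    (hP _ hw)
  · exact (((IsTestFunction.polynomial φ).mul hw.deriv).integrable hμ).add
      (((IsTestFunction.polynomial ψ).mul hw).integrable hμ)
  · have h0 := hw.contDiff.continuous
    have h1 := hw.deriv.contDiff.continuous
    fun_prop
  · rintro x ⟨hxt, hxy⟩
    have hxJ : x ∈ J := hJ.uIcc_subset hs hy (ray_inter_subset_uIcc hst ⟨hxt, hxy⟩)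
    have hτ : 0 < σ * (y - x) := by simpa [ray, mul_sub] using hxy
    have hσ : σ ≠ 0 := left_ne_zero_of_mul hτ.ne'
    have hχ : deriv (edgeBump σ s t y) x ≠ 0 := by
      rw [deriv_edgeBump hst hxt]
      exact mul_ne_zero (neg_ne_zero.2 hσ) (mul_ne_zero
        (pow_ne_zero 2 (inv_ne_zero hτ.ne')) (expNegInvGlue.pos_of_pos hτ).ne')
    have hode' : φ.eval x * v.eval x = ψ.eval x * u.eval x := by
      simpa only [eval_mul] using congrArg (eval x) hode
    rw [((hMderiv x hxJ).fun_mul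
      (contDiff_edgeBump.differentiable (by simp) x).hasDerivAt).deriv]
    convert mul_ne_zero (mul_ne_zero (hφ x ⟨hxt, hxy⟩) (hMpos x).ne') hχ using 1
    have := hu x hxJ
    field_simp
    linear_combination -M x * edgeBump σ s t y x * hode'
  · filter_upwards [ae_edgeBump_eventuallyEq_zero hst hty hnull] with x hx hxU
    have hzero : (fun x => M x * edgeBump σ s t y x) =ᶠ[𝓝 x] 0 := by
      filter_upwards [hx hxU] with z hz
      simp [hz]
    simp [hzero.deriv_eq, (hx hxU).eq_of_nhds]

theorem IsPearson.measure_eq_zero_of_isOpen [NullSingletonClass μ] (hP : IsPearson μ φ ψ)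
    (hμ : HasMoments μ) (hJo : IsOpen J) (hJ : J.OrdConnected) (hφ : ∀ x ∈ J, φ.eval x ≠ 0)
    {V : Set ℝ} (hV : IsOpen V) (hVJ : (V ∩ J).Nonempty) (hnull : μ V = 0) : μ J = 0 := by
  obtain ⟨p, hpV, hpJ⟩ := hVJ
  obtain ⟨ε, hε, hεV⟩ := Metric.isOpen_iff.1 hV p hpV
  refine measure_null_of_locally_null J fun x hx => ?_
  rcases eq_or_ne x p with rfl | hxp
  · exact ⟨V, mem_nhdsWithin_of_mem_nhds (hV.mem_nhds hpV), hnull⟩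
  obtain ⟨δ, hδ, hδJ⟩ := Metric.isOpen_iff.1 hJo x hx
  have hσ : x - p ≠ 0 := sub_ne_zero.2 hxp
  obtain ⟨t, ht, htp⟩ := exists_mem_ray_dist_lt hσ p (lt_min hε (dist_pos.2 hxp))
  obtain ⟨y, hy, hyx⟩ := exists_mem_ray_dist_lt hσ x hδ
  rw [lt_min_iff, dist_comm x] at htp
  have hmem : x ∈ ray (x - p) t ∩ ray (-(x - p)) y ∧ y ∈ ray (x - p) t := by
    simp only [ray, mem_inter_iff, mem_ofPred_eq, mul_pos_iff, Real.dist_eq] at ht htp hy ⊢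
    grind
  have hU := hP.measure_ray_inter_eq_zero hμ hJo hJ hφ (mul_comm φ ψ) hpJ (hδJ hyx) ht hmem.2
  refine ⟨_, mem_nhdsWithin_of_mem_nhds
    (((isOpen_ray _ _).inter (isOpen_ray _ _)).mem_nhds hmem.1), hU ?_ ?_⟩
  · refine measure_mono_null (fun z hz => hεV ?_) hnull
    rw [Metric.mem_ball]
    refine lt_trans ?_ htp.1
    simp only [ray, mem_inter_iff, mem_ofPred_eq, mul_pos_iff, Real.dist_eq] at ht hz ⊢
    grind
  · exact fun z hz => hφ z (hJ.uIcc_subset hpJ (hδJ hyx) (ray_inter_subset_uIcc ht hz))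

variable {r : ℝ} [NullSingletonClass μ] [NeZero μ]

theorem IsPearson.measure_ne_zero_of_isOpen (hP : IsPearson μ φ ψ) (hμ : HasMoments μ)
    (hσ : σ ≠ 0) (hnull : μ (ray (-σ) r) = 0) (hφ : ∀ x, φ.IsRoot x → x = r) {V : Set ℝ}
    (hV : IsOpen V) (hVr : (V ∩ ray σ r).Nonempty) : μ V ≠ 0 := fun h =>
  measure_ray_ne_zero hσ hnull (hP.measure_eq_zero_of_isOpen hμ (isOpen_ray σ r)
    (ordConnected_ray σ r) (fun x hx hx0 => by simp [ray, hφ x hx0] at hx) hV hVr h)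

theorem IsPearson.measure_ray_inter_ne_zero (hP : IsPearson μ φ ψ) (hμ : HasMoments μ)
    (hnull : μ (ray (-σ) r) = 0) (hφ : ∀ x, φ.IsRoot x → x = r) (hy : y ∈ ray σ r) :
    μ (ray σ r ∩ ray (-σ) y) ≠ 0 := by
  have hmid : (r + y) / 2 ∈ ray σ r ∩ ray (-σ) y := by
    simp only [ray, mem_inter_iff, mem_ofPred_eq, mul_pos_iff] at hy ⊢
    grind
  exact hP.measure_ne_zero_of_isOpen hμ (left_ne_zero_of_mul (ne_of_gt hy)) hnull hφ
    ((isOpen_ray σ r).inter (isOpen_ray (-σ) y)) ⟨_, hmid, hmid.1⟩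

theorem exists_isRoot_of_isPearson_pow_mul {m : ℕ}
    (hP : IsPearson μ ((X - C r) ^ m * u) ((X - C r) ^ m * v)) (hμ : HasMoments μ)
    (hσ : σ ≠ 0) (hnull : μ (ray (-σ) r) = 0) : ∃ x, u.IsRoot x := by
  by_contra! hu
  obtain ⟨y, hy, -⟩ := exists_mem_ray_dist_lt hσ r one_pos
  obtain ⟨s, hs⟩ : ∃ s, r ∈ ray σ s := ⟨r - σ, by simpa [ray] using hσ⟩
  have hφ : ∀ x, ((X - C r) ^ m * u).IsRoot x → x = r := by
    intro x hx
    rcases root_mul.1 hx with hx | hx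
    · simpa [sub_eq_zero] using eq_zero_of_pow_eq_zero ((eval_pow m).symm.trans hx)
    · exact absurd hx (hu x)
  refine hP.measure_ray_inter_ne_zero hμ hnull hφ hy ?_
  refine hP.measure_ray_inter_eq_zero (u := u) (v := v) hμ isOpen_univ ordConnected_univ
    (fun x _ => hu x) (by ring) (mem_univ s) (mem_univ y) hs hy
    (measure_mono_null inter_subset_right hnull) fun x hx hx0 => ?_
  simp [ray, hφ x hx0] at hx

end UniqueContinuation

section Growth

open Set Filter
open scoped Topology

variable {μ : Measure ℝ} {φ ψ : ℝ[X]} {σ : ℝ}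

theorem tendsto_integral_truncation (c : ContDiffBump (0 : ℝ)) {f g : ℝ → ℝ} (hf : Continuous f)
    (hg : Continuous g) (hfμ : Integrable f μ) (hgμ : Integrable g μ) :
    Tendsto (fun ε => ∫ x, c (ε * x) * f x + ε * deriv c (ε * x) * g x ∂μ) (𝓝[≠] 0)
      (𝓝 (∫ x, f x ∂μ)) := by
  have hc₀ : Continuous c := c.continuous
  have hc : Continuous (deriv c) := c.contDiff.continuous_deriv_one
  obtain ⟨B, hB⟩ := c.hasCompactSupport.deriv.exists_bound_of_continuous hc
  have hε : ∀ᶠ ε : ℝ in 𝓝[≠] 0, |ε| ≤ 1 := by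
    refine eventually_nhdsWithin_of_eventually_nhds ?_
    filter_upwards [Metric.closedBall_mem_nhds (0 : ℝ) one_pos] with ε hε using by simpa using hε
  refine tendsto_integral_filter_of_dominated_convergence (fun x => ‖f x‖ + B * ‖g x‖)
    (.of_forall fun ε => Continuous.aestronglyMeasurable (by fun_prop)) ?_
    (hfμ.norm.add (hgμ.norm.const_mul B)) (.of_forall fun x => ?_)
  · filter_upwards [hε] with ε hε
    refine .of_forall fun x => (norm_add_le _ _).trans (add_le_add ?_ ?_)
    · rw [norm_mul, Real.norm_of_nonneg c.nonneg]
      exact mul_le_of_le_one_left (norm_nonneg _) c.le_one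
    · rw [norm_mul, norm_mul]
      gcongr
      exact (mul_le_of_le_one_left (norm_nonneg _) hε).trans (hB _)
  · have hc_zero : c 0 = 1 := c.one_of_mem_closedBall (by simp [c.rIn_pos.le])
    refine Tendsto.mono_left (Continuous.tendsto' (by fun_prop) _ _ ?_) nhdsWithin_le_nhds
    simp [hc_zero]

theorem IsPearson.integral_eq_zero_of_integrable (hP : IsPearson μ φ ψ) {u : ℝ → ℝ}
    (hu : ContDiff ℝ ∞ u) (hu₀ : Integrable (fun x => φ.eval x * u x) μ)
    (hu₁ : Integrable (fun x => φ.eval x * deriv u x + ψ.eval x * u x) μ) :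
    ∫ x, φ.eval x * deriv u x + ψ.eval x * u x ∂μ = 0 := by
  let c : ContDiffBump (0 : ℝ) := default
  have hc : ContDiff ℝ ∞ c := c.contDiff
  have hderiv_cont : Continuous (deriv u) := hu.continuous_deriv (by simp)
  have hlim := tendsto_integral_truncation c (by fun_prop) (by fun_prop) hu₁ hu₀
  refine tendsto_nhds_unique hlim (tendsto_const_nhds.congr' ?_)
  filter_upwards [self_mem_nhdsWithin] with ε hε
  have hcomp : HasCompactSupport fun x => c (ε * x) :=
    c.hasCompactSupport.comp_homeomorph (Homeomorph.mulLeft₀ ε hε)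
  refine (hP (fun x => c (ε * x) * u x) (.inr ⟨by fun_prop, hcomp.mul_right⟩)).symm.trans ?_
  refine integral_congr_ae (.of_forall fun x => ?_)
  have hcε : HasDerivAt (fun x => c (ε * x)) (deriv c (ε * x) * ε) x := by
    refine (hc.differentiable (by simp) _).hasDerivAt.comp x ?_
    simpa using (hasDerivAt_id x).const_mul ε
  have hderiv := hcε.fun_mul (hu.differentiable (by simp) x).hasDerivAt
  simp only [hderiv.deriv]
  ring

theorem expNegInvGlue_le_one (x : ℝ) : expNegInvGlue x ≤ 1 := by
  unfold expNegInvGlue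
  split_ifs with hx
  · exact zero_le_one
  · exact Real.exp_le_one_iff.2 (neg_nonpos.2 (inv_nonneg.2 (not_le.1 hx).le))

theorem inv_sq_mul_expNegInvGlue_le_two (x : ℝ) : x⁻¹ ^ 2 * expNegInvGlue x ≤ 2 := by
  unfold expNegInvGlue
  split_ifs with hx
  · simp
  · have h := Real.quadratic_le_exp_of_nonneg (inv_nonneg.2 (not_le.1 hx).le)
    have hx' := inv_nonneg.2 (not_le.1 hx).le
    rw [Real.exp_neg, ← div_eq_mul_inv, div_le_iff₀ (Real.exp_pos _)]
    linarith

theorem eventually_pos_eval_mul {P : ℝ[X]} (hσ : σ ≠ 0)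
    (hP : 0 < P.leadingCoeff * σ ^ P.natDegree) : ∀ᶠ z in atTop, 0 < P.eval (σ * z) := by
  have hlc : 0 < (P.comp (C σ * X)).leadingCoeff := by
    rwa [leadingCoeff_comp (by simp [hσ]), leadingCoeff_C_mul_X]
  filter_upwards [eventually_ge_atTop ((P.comp (C σ * X)).cauchyBound : ℝ)] with z hz
  have hroots : ∀ w, (P.comp (C σ * X)).IsRoot w → w < z := fun w hw =>
    (le_abs_self w).trans_lt (lt_of_lt_of_le
      (by exact_mod_cast hw.norm_lt_cauchyBound (leadingCoeff_ne_zero.1 hlc.ne')) hz)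
  simpa [eval_comp] using zero_lt_eval_of_roots_lt_of_leadingCoeff_nonneg hroots hlc.le

/-- The smooth function equal to `x ^ k * exp (-1 / (σ * (x - y)))` on `ray σ y` and to zero
elsewhere: on a distant half-line it tests the Pearson equation with a function of constant sign. -/
noncomputable def tailPower (σ y : ℝ) (k : ℕ) (x : ℝ) : ℝ :=
  x ^ k * expNegInvGlue (σ * (x - y))

theorem contDiff_tailPower (σ y : ℝ) (k : ℕ) : ContDiff ℝ ∞ (tailPower σ y k) :=
  (contDiff_id.pow k).mul (expNegInvGlue.contDiff.comp (by fun_prop))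

theorem deriv_tailPower (σ y : ℝ) (k : ℕ) (x : ℝ) :
    deriv (tailPower σ y k) x = k * x ^ (k - 1) * expNegInvGlue (σ * (x - y)) +
      σ * x ^ k * ((σ * (x - y))⁻¹ ^ 2 * expNegInvGlue (σ * (x - y))) := by
  have hlin : HasDerivAt (fun x => σ * (x - y)) σ x := by
    simpa using ((hasDerivAt_id x).sub_const y).const_mul σ
  refine ((hasDerivAt_pow k x).mul ((hasDerivAt_expNegInvGlue _).comp x hlin)).deriv.trans ?_
  rw [Function.comp_apply]
  ring

theorem pearson_tailPower_ne_zero {y x : ℝ} {k : ℕ} (hx : x ∈ ray σ y) (hσx : 0 < σ * x)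
    (hsign : 0 < φ.eval x * (k * φ.eval x + x * ψ.eval x)) :
    φ.eval x * deriv (tailPower σ y k) x + ψ.eval x * tailPower σ y k x ≠ 0 := by
  intro h
  have hτ : 0 < σ * (x - y) := hx
  have hpow : (k : ℝ) * x ^ (k - 1) * x = k * x ^ k := by
    cases k <;> simp [pow_succ, mul_assoc]
  rw [deriv_tailPower, tailPower] at h
  generalize σ * (x - y) = τ at hτ h
  have hfactor : x ^ k * expNegInvGlue τ *
      (τ ^ 2 * (k * φ.eval x + x * ψ.eval x) + σ * x * φ.eval x) = 0 := by
    field_simp at h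
    linear_combination x * h - φ.eval x * expNegInvGlue τ * τ ^ 2 * hpow
  have hbracket := (mul_eq_zero.1 hfactor).resolve_left
    (mul_ne_zero (pow_ne_zero k (right_ne_zero_of_mul hσx.ne')) (expNegInvGlue.pos_of_pos hτ).ne')
  have hpos : 0 < τ ^ 2 * (φ.eval x * (k * φ.eval x + x * ψ.eval x)) + σ * x * φ.eval x ^ 2 := by
    positivity
  exact hpos.ne' (by linear_combination φ.eval x * hbracket)

theorem HasMoments.integrable_eval_mul_bdd (hμ : HasMoments μ) (q : ℝ[X]) {f : ℝ → ℝ} {c : ℝ}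
    (hf : Measurable f) (hc : ∀ x, |f x| ≤ c) : Integrable (fun x => q.eval x * f x) μ :=
  ((IsTestFunction.polynomial q).integrable hμ).mul_bdd hf.aestronglyMeasurable (.of_forall hc)

theorem IsPearson.integral_tailPower (hP : IsPearson μ φ ψ) (hμ : HasMoments μ) (σ y : ℝ)
    (k : ℕ) : Integrable (fun x => φ.eval x * deriv (tailPower σ y k) x +
        ψ.eval x * tailPower σ y k x) μ ∧
      ∫ x, φ.eval x * deriv (tailPower σ y k) x + ψ.eval x * tailPower σ y k x ∂μ = 0 := by
  have hglue : Measurable fun x => expNegInvGlue (σ * (x - y)) :=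
    (expNegInvGlue.contDiff.continuous (n := 0)).measurable.comp (by fun_prop)
  have h₀ (q : ℝ[X]) := hμ.integrable_eval_mul_bdd q hglue fun x =>
    (abs_of_nonneg (expNegInvGlue.nonneg _)).trans_le (expNegInvGlue_le_one _)
  have h₁ (q : ℝ[X]) := hμ.integrable_eval_mul_bdd q
    (f := fun x => (σ * (x - y))⁻¹ ^ 2 * expNegInvGlue (σ * (x - y))) (by fun_prop) fun x =>
    (abs_of_nonneg (mul_nonneg (sq_nonneg _) (expNegInvGlue.nonneg _))).trans_le
      (inv_sq_mul_expNegInvGlue_le_two _)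
  have hint : Integrable (fun x => φ.eval x * deriv (tailPower σ y k) x +
      ψ.eval x * tailPower σ y k x) μ := by
    refine ((h₀ (φ * (C (k : ℝ) * X ^ (k - 1)) + ψ * X ^ k)).add
      (h₁ (φ * (C σ * X ^ k)))).congr (.of_forall fun x => ?_)
    simp only [deriv_tailPower, tailPower, Pi.add_apply, eval_add, eval_mul, eval_C, eval_pow,
      eval_X]
    ring
  refine ⟨hint, hP.integral_eq_zero_of_integrable (contDiff_tailPower σ y k) ?_ hint⟩
  refine (h₀ (φ * X ^ k)).congr (.of_forall fun x => ?_)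
  simp only [tailPower, eval_mul, eval_pow, eval_X]
  ring

theorem IsPearson.exists_null_ray (hP : IsPearson μ φ ψ) (hμ : HasMoments μ) (hσ : σ ≠ 0) (k : ℕ)
    (hsign : 0 < (φ * (C (k : ℝ) * φ + X * ψ)).leadingCoeff *
      σ ^ (φ * (C (k : ℝ) * φ + X * ψ)).natDegree) : ∃ y, μ (ray σ y) = 0 := by
  obtain ⟨Z, hZ⟩ := eventually_atTop.1
    ((eventually_pos_eval_mul hσ hsign).and (eventually_gt_atTop 0))
  refine ⟨σ * Z, ?_⟩
  obtain ⟨hint, hzero⟩ := hP.integral_tailPower hμ σ (σ * Z) k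
  have hcont : Continuous fun x => φ.eval x * deriv (tailPower σ (σ * Z) k) x +
      ψ.eval x * tailPower σ (σ * Z) k x := by
    have h₀ := (contDiff_tailPower σ (σ * Z) k).continuous
    have h₁ := (contDiff_tailPower σ (σ * Z) k).continuous_deriv (by simp)
    fun_prop
  refine measure_eq_zero_of_integral_eq_zero hint hcont (ordConnected_ray _ _).isPreconnected
    (fun x hx hFx => ?_) (.of_forall fun x hx => ?_) hzero
  · have hZx : Z ≤ x / σ := by
      have : 0 < (x / σ - Z) * σ ^ 2 := by
        convert show 0 < σ * (x - σ * Z) from hx using 1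
        field_simp
      exact (sub_pos.1 (pos_of_mul_pos_left this (sq_nonneg σ))).le
    obtain ⟨hρ, hxσ⟩ := hZ _ hZx
    rw [mul_div_cancel₀ _ hσ] at hρ
    have hσx : 0 < σ * x := by
      have : x / σ * σ ^ 2 = σ * x := by field_simp
      exact this ▸ mul_pos hxσ (sq_pos_of_ne_zero hσ)
    exact pearson_tailPower_ne_zero hx hσx (by simpa using hρ) hFx
  · simp [deriv_tailPower, tailPower, expNegInvGlue.zero_of_nonpos (not_lt.1 hx)]

end Growth

section DegreeComparison

open Set

variable {μ : Measure ℝ} {φ ψ : ℝ[X]} {σ r : ℝ}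

theorem IsPearson.exists_null_ray_of_natDegree_X_mul_le (hP : IsPearson μ φ ψ) (hμ : HasMoments μ)
    (hφ : φ ≠ 0) (hdeg : (X * ψ).natDegree ≤ φ.natDegree) (hσ : σ ≠ 0) :
    ∃ y, μ (ray σ y) = 0 := by
  obtain ⟨k, hk⟩ := exists_nat_gt
    (-(φ.leadingCoeff * (X * ψ).coeff φ.natDegree) / φ.leadingCoeff ^ 2)
  have hlc : φ.leadingCoeff ≠ 0 := leadingCoeff_ne_zero.2 hφ
  have hcoeff : (C (k : ℝ) * φ + X * ψ).coeff φ.natDegree =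
      k * φ.leadingCoeff + (X * ψ).coeff φ.natDegree := by
    simp [coeff_add]
  have hpos : 0 < φ.leadingCoeff * (C (k : ℝ) * φ + X * ψ).coeff φ.natDegree := by
    rw [div_lt_iff₀ (by positivity)] at hk
    rw [hcoeff]
    linarith
  have hnat : (C (k : ℝ) * φ + X * ψ).natDegree = φ.natDegree :=
    natDegree_eq_of_le_of_coeff_ne_zero
      (natDegree_add_le_of_degree_le (natDegree_C_mul_le _ _) hdeg) (right_ne_zero_of_mul hpos.ne')
  have hθ : C (k : ℝ) * φ + X * ψ ≠ 0 := fun h => by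
    rw [h, coeff_zero, mul_zero] at hpos
    exact hpos.false
  have hlead : (C (k : ℝ) * φ + X * ψ).leadingCoeff =
      (C (k : ℝ) * φ + X * ψ).coeff φ.natDegree := by
    rw [leadingCoeff, hnat]
  refine hP.exists_null_ray hμ hσ k ?_
  rw [leadingCoeff_mul, natDegree_mul hφ hθ, hlead, hnat]
  exact mul_pos hpos (Even.pow_pos ⟨_, rfl⟩ hσ)

theorem IsPearson.exists_null_ray_of_natDegree_eq (hP : IsPearson μ φ ψ) (hμ : HasMoments μ)
    (hφ : φ ≠ 0) (hψ : ψ ≠ 0) (hdeg : φ.natDegree = ψ.natDegree) :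
    ∃ y, μ (ray (φ.leadingCoeff * ψ.leadingCoeff) y) = 0 := by
  have hσ : φ.leadingCoeff * ψ.leadingCoeff ≠ 0 :=
    mul_ne_zero (leadingCoeff_ne_zero.2 hφ) (leadingCoeff_ne_zero.2 hψ)
  refine hP.exists_null_ray hμ hσ 0 ?_
  rw [Nat.cast_zero, C_0, zero_mul, zero_add, leadingCoeff_mul, leadingCoeff_mul, leadingCoeff_X,
    one_mul, natDegree_mul hφ (mul_ne_zero X_ne_zero hψ), natDegree_X_mul hψ, ← pow_succ', hdeg]
  exact Even.pow_pos ⟨ψ.natDegree + 1, by ring⟩ hσ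

variable [NullSingletonClass μ] [NeZero μ]

theorem IsPearson.natDegree_lt (hP : IsPearson μ φ ψ) (hμ : HasMoments μ)
    (hφ : ∀ x, φ.eval x ≠ 0) : φ.natDegree < ψ.natDegree := by
  have hno_ray (σ y : ℝ) (hσ : σ ≠ 0) : μ (ray σ y) ≠ 0 := fun h => by
    obtain ⟨z, hz, -⟩ := exists_mem_ray_dist_lt hσ y one_pos
    exact NeZero.ne (μ univ) (hP.measure_eq_zero_of_isOpen hμ isOpen_univ ordConnected_univ
      (fun x _ => hφ x) (isOpen_ray σ y) ⟨z, hz, mem_univ z⟩ h)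
  have hφ₀ : φ ≠ 0 := fun h => hφ 0 (by simp [h])
  have hX : φ.natDegree < (X * ψ).natDegree := by
    by_contra! hle
    obtain ⟨y, hy⟩ := hP.exists_null_ray_of_natDegree_X_mul_le hμ hφ₀ hle one_ne_zero
    exact hno_ray 1 y one_ne_zero hy
  have hψ₀ : ψ ≠ 0 := right_ne_zero_of_mul (ne_zero_of_natDegree_gt hX)
  rw [natDegree_X_mul hψ₀, Nat.lt_succ_iff] at hX
  refine hX.lt_of_ne fun heq => ?_
  obtain ⟨y, hy⟩ := hP.exists_null_ray_of_natDegree_eq hμ hφ₀ hψ₀ heq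
  exact hno_ray _ y (mul_ne_zero (leadingCoeff_ne_zero.2 hφ₀) (leadingCoeff_ne_zero.2 hψ₀)) hy

theorem IsPearson.natDegree_le (hP : IsPearson μ φ ψ) (hμ : HasMoments μ) (hσ : σ ≠ 0)
    (hnull : μ (ray (-σ) r) = 0) (hφ : ∀ x, φ.IsRoot x → x = r) :
    φ.natDegree ≤ ψ.natDegree := by
  by_contra! hlt
  obtain ⟨y, hy⟩ := hP.exists_null_ray_of_natDegree_X_mul_le hμ (ne_zero_of_natDegree_gt hlt)
    (natDegree_mul_le.trans (by rw [natDegree_X]; omega)) hσ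
  refine hP.measure_ne_zero_of_isOpen hμ hσ hnull hφ (isOpen_ray σ y)
    (ray_inter_ray_nonempty hσ y r) hy

end DegreeComparison

section UniqueRoot

variable {μ : Measure ℝ} [NullSingletonClass μ] [NeZero μ] {φ ψ f g h : ℝ[X]} {σ r : ℝ}

theorem IsPearson.natDegree_dichotomy (hP : IsPearson μ φ ψ) (hμ : HasMoments μ)
    (hQ : IsSecondOrderPearson μ f g h) (hf : f.natDegree = ψ.natDegree)
    (hφ : φ.natDegree ≤ ψ.natDegree) :
    2 * ψ.natDegree ≤ g.natDegree + φ.natDegree ∨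
      3 * ψ.natDegree ≤ h.natDegree + 2 * φ.natDegree := by
  refine or_iff_not_imp_left.2 fun hg => ?_
  exact three_mul_natDegree_le_of_flux_relation (hQ.flux_relation hμ hP) hf hφ (by omega)

theorem IsPearson.rootMultiplicity_lt (hP : IsPearson μ φ ψ) (hμ : HasMoments μ) (hσ : σ ≠ 0)
    (hnull : μ (ray (-σ) r) = 0) (hφ : ∀ x, φ.IsRoot x → x = r) (hφ₀ : φ ≠ 0) (hψ₀ : ψ ≠ 0) :
    ψ.rootMultiplicity r < φ.rootMultiplicity r := by
  by_contra! hle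
  obtain ⟨u, hu, hndvd⟩ := exists_eq_pow_rootMultiplicity_mul_and_not_dvd φ hφ₀ r
  obtain ⟨v, hv⟩ := (le_rootMultiplicity_iff hψ₀).1 hle
  rw [hu, hv] at hP
  obtain ⟨x, hx⟩ := exists_isRoot_of_isPearson_pow_mul hP hμ hσ hnull
  obtain rfl : x = r := hφ x (by rw [hu]; exact root_mul_left_of_isRoot _ hx)
  exact hndvd (dvd_iff_isRoot.2 hx)

theorem IsSecondOrderPearson.isRoot (hQ : IsSecondOrderPearson μ f g h) (hμ : HasMoments μ)
    (hP : IsPearson μ φ ψ) (hσ : σ ≠ 0) (hnull : μ (ray (-σ) r) = 0)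
    (hφ : ∀ x, φ.IsRoot x → x = r) : f.IsRoot r := by
  by_contra hf
  obtain ⟨y, hy, hzero⟩ := hQ.exists_null_ray_inter hμ hσ hnull hf
  exact hP.measure_ray_inter_ne_zero hμ hnull hφ hy hzero

end UniqueRoot

theorem rootMultiplicity_le_natDegree {R : Type*} [CommRing R] [IsDomain R] (p : R[X]) (r : R) :
    p.rootMultiplicity r ≤ p.natDegree := by
  classical
  exact (count_roots p).ge.trans ((Multiset.count_le_card r p.roots).trans (card_roots' p))

theorem natDegree_eq_add_of_eq_pow_mul {R : Type*} [CommRing R] [IsDomain R] {p q : R[X]} {r : R}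
    {m : ℕ} (hp : p ≠ 0) (h : p = (X - C r) ^ m * q) : p.natDegree = m + q.natDegree := by
  have hq : q ≠ 0 := right_ne_zero_of_mul (h ▸ hp)
  rw [h, natDegree_mul (pow_ne_zero _ (X_sub_C_ne_zero r)) hq, natDegree_pow, natDegree_X_sub_C,
    mul_one]

theorem coeff_sum_monomial_Icc {R : Type*} [Semiring R] {n k : ℕ} (a : ℕ → R)
    (hk : k ∈ Finset.Icc 1 n) :
    (∑ k ∈ Finset.Icc 1 n, monomial k (a k)).coeff k = a k := by
  rw [finsetSum_coeff,
    Finset.sum_eq_single_of_mem k hk fun j _ hj => coeff_monomial_of_ne _ hj.symm,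
    coeff_monomial_same]

theorem natDegree_sum_monomial_Icc {R : Type*} [Semiring R] {n : ℕ} {a : ℕ → R} (hn : 1 ≤ n)
    (ha : a n ≠ 0) :
    (∑ k ∈ Finset.Icc 1 n, monomial k (a k)).natDegree = n := by
  refine natDegree_eq_of_le_of_coeff_ne_zero (natDegree_sum_le_of_forall_le _ _ fun k hk =>
    (natDegree_monomial_le _).trans (Finset.mem_Icc.1 hk).2) ?_
  rwa [coeff_sum_monomial_Icc a (Finset.mem_Icc.2 ⟨hn, le_rfl⟩)]

/-- The operator `diffOp n a` is symmetric in `L²(μ)` on the test functions. -/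
def IsSymmetricDiffOp (μ : Measure ℝ) (n : ℕ) (a : ℕ → ℝ[X]) : Prop :=
  ∀ u v : ℝ → ℝ, IsTestFunction u → IsTestFunction v →
    ∫ x, diffOp n a u x * v x ∂μ = ∫ x, u x * diffOp n a v x ∂μ

namespace IsSymmetricDiffOp

variable {μ : Measure ℝ} {n : ℕ} {a : ℕ → ℝ[X]}

theorem isSymmWithSign (hsymm : IsSymmetricDiffOp μ n a) :
    IsSymmWithSign μ 1 (∑ k ∈ Finset.Icc 1 n, monomial k (a k)) := fun u v hu hv => by
  simpa only [diffOp_eq_symbolOp, one_mul] using hsymm u v hu hv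

variable [NullSingletonClass μ] [NeZero μ]

protected theorem even (hsymm : IsSymmetricDiffOp μ n a) (hμ : HasMoments μ) (hn : 1 ≤ n)
    (ha : a n ≠ 0) : Even n := by
  have hdeg := natDegree_sum_monomial_Icc hn ha
  rw [← hdeg]
  exact hsymm.isSymmWithSign.even_natDegree hμ (ne_zero_of_natDegree_gt (n := 0) (by omega))

theorem three_lt (hsymm : IsSymmetricDiffOp μ n a) (hμ : HasMoments μ) (hn : 2 < n)
    (ha : a n ≠ 0) : 3 < n := by
  obtain ⟨k, hk⟩ := hsymm.even hμ (by omega) ha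
  omega

theorem isPearson (hsymm : IsSymmetricDiffOp μ n a) (hμ : HasMoments μ) (hn : 1 < n)
    (ha : a n ≠ 0) : ∃ κ ≠ 0, IsPearson μ (a n) (C κ * a (n - 1)) := by
  obtain ⟨m, rfl⟩ := Nat.exists_eq_add_of_le' hn
  have h := hsymm.isSymmWithSign.isPearson hμ (m := m + 1)
    (natDegree_sum_monomial_Icc (by omega) ha)
  rw [coeff_sum_monomial_Icc a (by simp), coeff_sum_monomial_Icc a (by simp)] at h
  exact ⟨_, by positivity, h⟩

theorem isSecondOrderPearson (hsymm : IsSymmetricDiffOp μ n a) (hμ : HasMoments μ) (hn : 2 < n)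
    (ha : a n ≠ 0) : ∃ κ ≠ 0, ∃ c : ℝ,
      IsSecondOrderPearson μ (C κ * a (n - 1)) (C c * a (n - 2)) (2 * a (n - 3)) := by
  obtain ⟨m, rfl⟩ := Nat.exists_eq_add_of_le' (hsymm.three_lt hμ hn ha)
  have h := hsymm.isSymmWithSign.isSecondOrderPearson hμ (m := m + 1)
    (natDegree_sum_monomial_Icc (by omega) ha)
  rw [coeff_sum_monomial_Icc a (by simp), coeff_sum_monomial_Icc a (by simp),
    coeff_sum_monomial_Icc a (by simp)] at h
  exact ⟨_, by positivity, _, h⟩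

theorem natDegree_dichotomy (hsymm : IsSymmetricDiffOp μ n a) (hμ : HasMoments μ) (hn : 2 < n)
    (ha : a n ≠ 0) (hc : (a (n - 2)).natDegree ≤ n - 2) (hd : (a (n - 3)).natDegree ≤ n - 3)
    (hab : (a n).natDegree ≤ (a (n - 1)).natDegree) :
    2 * (a (n - 1)).natDegree ≤ n - 2 + (a n).natDegree ∨
      3 * (a (n - 1)).natDegree ≤ n - 3 + 2 * (a n).natDegree := by
  obtain ⟨κ, hκ, hP⟩ := hsymm.isPearson hμ (by omega) ha
  obtain ⟨l, hl, c, hQ⟩ := hsymm.isSecondOrderPearson hμ hn ha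
  have h := hP.natDegree_dichotomy hμ hQ
  simp only [natDegree_C_mul hκ, natDegree_C_mul hl, true_imp_iff] at h
  have hg := natDegree_C_mul_le c (a (n - 2))
  have hh : (2 * a (n - 3)).natDegree = (a (n - 3)).natDegree :=
    natDegree_C_mul (two_ne_zero' ℝ)
  exact (h hab).imp (by omega) (by omega)

theorem natDegree_lt (hsymm : IsSymmetricDiffOp μ n a) (hμ : HasMoments μ) (hn : 1 < n)
    (ha : ∀ x, ¬ (a n).IsRoot x) : (a n).natDegree < (a (n - 1)).natDegree := by
  obtain ⟨κ, hκ, hP⟩ := hsymm.isPearson hμ hn fun h => ha 0 (by simp [h])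
  exact natDegree_C_mul (p := a (n - 1)) hκ ▸ hP.natDegree_lt hμ ha

variable {r : ℝ}

theorem natDegree_le (hsymm : IsSymmetricDiffOp μ n a) (hμ : HasMoments μ) (hn : 1 < n)
    (ha : a n ≠ 0) (hroot : ∀ x, (a n).IsRoot x → x = r)
    (hside : μ (Set.Iio r) = 0 ∨ μ (Set.Ioi r) = 0) :
    (a n).natDegree ≤ (a (n - 1)).natDegree := by
  obtain ⟨κ, hκ, hP⟩ := hsymm.isPearson hμ hn ha
  obtain ⟨σ, hσ, hnull⟩ := exists_measure_ray_neg_eq_zero hside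
  exact natDegree_C_mul (p := a (n - 1)) hκ ▸ hP.natDegree_le hμ hσ hnull hroot

theorem isRoot (hsymm : IsSymmetricDiffOp μ n a) (hμ : HasMoments μ) (hn : 2 < n)
    (ha : a n ≠ 0) (hroot : ∀ x, (a n).IsRoot x → x = r)
    (hside : μ (Set.Iio r) = 0 ∨ μ (Set.Ioi r) = 0) : (a (n - 1)).IsRoot r := by
  obtain ⟨κ, -, hP⟩ := hsymm.isPearson hμ (by omega) ha
  obtain ⟨l, hl, c, hQ⟩ := hsymm.isSecondOrderPearson hμ hn ha
  obtain ⟨σ, hσ, hnull⟩ := exists_measure_ray_neg_eq_zero hside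
  simpa [hl] using hQ.isRoot hμ hP hσ hnull hroot

theorem rootMultiplicity_lt (hsymm : IsSymmetricDiffOp μ n a) (hμ : HasMoments μ) (hn : 1 < n)
    (ha : a n ≠ 0) (hb : a (n - 1) ≠ 0) (hroot : ∀ x, (a n).IsRoot x → x = r)
    (hside : μ (Set.Iio r) = 0 ∨ μ (Set.Ioi r) = 0) :
    (a (n - 1)).rootMultiplicity r < (a n).rootMultiplicity r := by
  obtain ⟨κ, hκ, hP⟩ := hsymm.isPearson hμ hn ha
  obtain ⟨σ, hσ, hnull⟩ := exists_measure_ray_neg_eq_zero hside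
  have hκb : C κ * a (n - 1) ≠ 0 := mul_ne_zero (C_ne_zero.2 hκ) hb
  have h := hP.rootMultiplicity_lt hμ hσ hnull hroot ha hκb
  rwa [rootMultiplicity_mul hκb, rootMultiplicity_C, zero_add] at h

end IsSymmetricDiffOp

theorem proposition3p6_general {μ : Measure ℝ} [NullSingletonClass μ] [NeZero μ]
    (hμ : HasMoments μ) (n : ℕ) (hn : 2 < n) (a : ℕ → ℝ[X]) (ha : a n ≠ 0)
    (hdeg : ∀ k ∈ Finset.Icc 1 n, (a k).natDegree ≤ k) (hsymm : IsSymmetricDiffOp μ n a)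
    (hroot : ∀ r s : ℝ, (a n).IsRoot r → (a n).IsRoot s → r = s)
    (hside : ∀ r : ℝ, (a n).IsRoot r → μ (Set.Iio r) = 0 ∨ μ (Set.Ioi r) = 0) :
    (2 * ((a (n - 1)).natDegree : ℤ) - (a n).natDegree ≤ n - 2 ∨
      3 * ((a (n - 1)).natDegree : ℤ) - 2 * (a n).natDegree ≤ n - 3) ∧
    ((∀ r : ℝ, ¬ (a n).IsRoot r) →
      (a n).natDegree < (a (n - 1)).natDegree ∧ ((a (n - 1)).natDegree : ℤ) ≤ n - 3) ∧
    (∀ r : ℝ, (a n).IsRoot r →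
      (2 ≤ (a n).natDegree ∧ (a n).natDegree ≤ (a (n - 1)).natDegree ∧
        ((a (n - 1)).natDegree : ℤ) ≤ n - 2) ∧
      ∀ u v : ℝ[X],
        a n = (X - C r) ^ (a n).rootMultiplicity r * u →
        a (n - 1) = (X - C r) ^ (a (n - 1)).rootMultiplicity r * v →
          1 + u.natDegree ≤ v.natDegree ∧ (v.natDegree : ℤ) ≤ n - 3) := by
  have hunique (r : ℝ) (hr : (a n).IsRoot r) (x : ℝ) (hx : (a n).IsRoot x) : x = r :=
    hroot x r hx hr
  have hab : (a n).natDegree ≤ (a (n - 1)).natDegree := by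
    by_cases hno : ∃ r, (a n).IsRoot r
    · obtain ⟨r, hr⟩ := hno
      exact hsymm.natDegree_le hμ (by omega) ha (hunique r hr) (hside r hr)
    · exact (hsymm.natDegree_lt hμ (by omega) (not_exists.1 hno)).le
  have hn' := hsymm.three_lt hμ hn ha
  have hdich := hsymm.natDegree_dichotomy hμ hn ha (hdeg (n - 2) (Finset.mem_Icc.2 (by omega)))
    (hdeg (n - 3) (Finset.mem_Icc.2 (by omega))) hab
  refine ⟨by omega, fun hno => ?_, fun r hr => ?_⟩
  · have hlt := hsymm.natDegree_lt hμ (by omega) hno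
    omega
  · have hb : a (n - 1) ≠ 0 := by
      have hpos : 0 < (a n).natDegree :=
        ((rootMultiplicity_pos ha).2 hr).trans_le (rootMultiplicity_le_natDegree (a n) r)
      exact ne_zero_of_natDegree_gt (hpos.trans_le hab)
    have hβ := (rootMultiplicity_pos hb).2 (hsymm.isRoot hμ hn ha (hunique r hr) (hside r hr))
    have hβα := hsymm.rootMultiplicity_lt hμ (by omega) ha hb (hunique r hr) (hside r hr)
    have hα := rootMultiplicity_le_natDegree (a n) r
    refine ⟨by omega, fun u v hu hv => ?_⟩
    have hA := natDegree_eq_add_of_eq_pow_mul ha hu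
    have hB := natDegree_eq_add_of_eq_pow_mul hb hv
    omega

/-- The measure `p dx` on `I`. -/
noncomputable def weightMeasure (I : Set ℝ) (p : ℝ → ℝ) : Measure ℝ :=
  (volume.restrict I).withDensity fun x => ENNReal.ofReal (p x)

instance weightMeasure.nullSingletonClass (I : Set ℝ) (p : ℝ → ℝ) :
    NullSingletonClass (weightMeasure I p) :=
  nullSingletonClass_withDensity _

theorem weightMeasure_eq_zero_of_disjoint {I s : Set ℝ} (p : ℝ → ℝ) (hs : MeasurableSet s)
    (h : Disjoint s I) : weightMeasure I p s = 0 := by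
  refine withDensity_absolutelyContinuous _ _ ?_
  rw [Measure.restrict_apply hs, h.inter_eq, measure_empty]

theorem disjoint_Iio_or_disjoint_Ioi {I : Set ℝ} (hI : I.OrdConnected) {r : ℝ} (hr : r ∉ I) :
    Disjoint (Set.Iio r) I ∨ Disjoint (Set.Ioi r) I := by
  simp only [Set.disjoint_left]
  by_contra! h
  obtain ⟨⟨x, hx, hxI⟩, y, hy, hyI⟩ := h
  exact hr (hI.out hxI hyI ⟨hx.le, hy.le⟩)

namespace IsAdmissibleWeight

variable {I : Set ℝ} {p : ℝ → ℝ}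

theorem aemeasurable_ofReal (hp : IsAdmissibleWeight I p) :
    AEMeasurable (fun x => ENNReal.ofReal (p x)) (volume.restrict I) := by
  have h := (hp.integrable 1).aestronglyMeasurable.aemeasurable
  simp only [eval_one, mul_one] at h
  exact h.ennreal_ofReal

theorem integral_weightMeasure (hp : IsAdmissibleWeight I p) (hI : MeasurableSet I) (f : ℝ → ℝ) :
    ∫ x, f x ∂weightMeasure I p = ∫ x in I, p x * f x := by
  rw [weightMeasure, integral_withDensity_eq_integral_toReal_smul₀ hp.aemeasurable_ofReal
    (.of_forall fun x => ENNReal.ofReal_lt_top)]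
  refine setIntegral_congr_fun hI fun x hx => ?_
  rw [ENNReal.toReal_ofReal (hp.nonneg x hx), smul_eq_mul]

theorem hasMoments (hp : IsAdmissibleWeight I p) (hI : MeasurableSet I) :
    HasMoments (weightMeasure I p) := by
  intro q
  rw [weightMeasure, integrable_withDensity_iff_integrable_smul₀' hp.aemeasurable_ofReal
    (.of_forall fun x => ENNReal.ofReal_lt_top)]
  refine (hp.integrable q).congr_fun (fun x hx => ?_) hI
  rw [ENNReal.toReal_ofReal (hp.nonneg x hx), smul_eq_mul]

theorem neZero_weightMeasure (hp : IsAdmissibleWeight I p) (hI : IsOpen I) :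
    NeZero (weightMeasure I p) := by
  obtain ⟨F, hF, hsmooth, x₀, hx₀, hpos⟩ := hp.piecewise_smooth
  have hU : I \ F ∈ nhds x₀ := (hI.sdiff hF.isClosed).mem_nhds hx₀
  have hpos_nhds : {x | 0 < p x} ∩ I ∈ nhds x₀ :=
    Filter.inter_mem ((hsmooth.continuousOn.continuousAt hU).eventually (lt_mem_nhds hpos))
      (Filter.mem_of_superset hU Set.sdiff_subset)
  refine ⟨fun h => (Measure.measure_pos_of_mem_nhds volume hpos_nhds).ne' ?_⟩
  rw [weightMeasure, withDensity_eq_zero_iff hp.aemeasurable_ofReal, Filter.EventuallyEq,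
    ae_restrict_iff' hI.measurableSet] at h
  refine measure_eq_zero_iff_ae_notMem.2 ?_
  filter_upwards [h] with x hx hx'
  exact hx'.1.not_ge (ENNReal.ofReal_eq_zero.1 (hx hx'.2))

end IsAdmissibleWeight

theorem IsSelfAdjointDiffOp.exists_measure {n : ℕ} {a : ℕ → ℝ[X]} (hL : IsSelfAdjointDiffOp n a) :
    ∃ μ : Measure ℝ, NullSingletonClass μ ∧ NeZero μ ∧ HasMoments μ ∧ IsSymmetricDiffOp μ n a ∧
      ∀ r, (a n).IsRoot r → μ (Set.Iio r) = 0 ∨ μ (Set.Ioi r) = 0 := by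
  obtain ⟨-, -, I, p, hIo, hI, -, hIa, hp, hsymm⟩ := hL
  refine ⟨weightMeasure I p, inferInstance, hp.neZero_weightMeasure hIo,
    hp.hasMoments hIo.measurableSet, fun u v hu hv => ?_, fun r hr => ?_⟩
  · simp only [hp.integral_weightMeasure hIo.measurableSet, ← mul_assoc]
    exact hsymm u v hu hv
  · exact (disjoint_Iio_or_disjoint_Ioi hI fun h => hIa r h hr).imp
      (weightMeasure_eq_zero_of_disjoint p measurableSet_Iio)
      (weightMeasure_eq_zero_of_disjoint p measurableSet_Ioi)

theorem proposition3p6 (n : ℕ) (hn : 2 < n) (a : ℕ → ℝ[X])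
    (hL : IsSelfAdjointDiffOp n a)
    (hroot : ∀ r s : ℝ, (a n).IsRoot r → (a n).IsRoot s → r = s) :
    (2 * ((a (n - 1)).natDegree : ℤ) - (a n).natDegree ≤ n - 2 ∨
      3 * ((a (n - 1)).natDegree : ℤ) - 2 * (a n).natDegree ≤ n - 3) ∧
    ((∀ r : ℝ, ¬ (a n).IsRoot r) →
      (a n).natDegree < (a (n - 1)).natDegree ∧ ((a (n - 1)).natDegree : ℤ) ≤ n - 3) ∧
    (∀ r : ℝ, (a n).IsRoot r →
      (2 ≤ (a n).natDegree ∧ (a n).natDegree ≤ (a (n - 1)).natDegree ∧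
        ((a (n - 1)).natDegree : ℤ) ≤ n - 2) ∧
      ∀ u v : ℝ[X],
        a n = (X - C r) ^ (a n).rootMultiplicity r * u →
        a (n - 1) = (X - C r) ^ (a (n - 1)).rootMultiplicity r * v →
          1 + u.natDegree ≤ v.natDegree ∧ (v.natDegree : ℤ) ≤ n - 3) := by
  obtain ⟨μ, _, _, hμ, hsymm, hside⟩ := hL.exists_measure
  exact proposition3p6_general hμ n hn a hL.1 hL.2.1 hsymm hroot hside
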